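/- Let $n\ge 0$ and let $g=\sum_{i=1}^n g_i\,\delta_{\xi_i}$ with $g_i>0$ and $0<\xi_1<\dots<\xi_n\le 1$. Call $g$ nondegenerate if all $\xi_i<1$. Write $(f,h)_g=\int_{[0,1]} f h\,dg$ (bilinear), and let $L^2_g$ be the space of complex valued square integrable functions with respect to $g$. For $z\in\mathbb C$ let $\varphi(\cdot;z)$ be the solution on $[0,1]$ of $$-\varphi_{\xi\xi\xi}=z\,g\,\varphi,\qquad \varphi(0)=\varphi_\xi(0)=0,\quad \varphi_{\xi\xi}(0)=1,$$ and for $a\in\{0,1,2\}$ let $\varphi_a^*(\cdot;z)$ be the solution of $\varphi^*_{\xi\xi\xi}=z\,g\,\varphi^*$ for which $(\varphi^*,\varphi^*_\xi,\varphi^*_{\xi\xi})$ at $\xi=1$ equals $(0,0,1)$ if $a=0$, $(0,1,0)$ if $a=1$, and $(1,0,0)$ if $a=2$. (The equations hold in the sense of measures: $\varphi$ is $C^1$ and $d\varphi_{\xi\xi}=-z\varphi\,dg$, respectively $d\varphi^*_{\xi\xi}=z\varphi^*dg$; if $\xi_n=1$, values of second derivatives at $1$ are right-hand limits, i.e. taken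 after the jump at $1$.) The spectrum $\sigma_a$ of type $a$ is the set of all $z\in\mathbb C$ for which $-u_{\xi\xi\xi}=z\,g\,u$, $u(0)=u_\xi(0)=0$ has a nontrivial solution on $[0,1]$ with $u(1)=0$ (type $0$), $u_\xi(1)=0$ (type $1$), $u_{\xi\xi}(1)=0$ (type $2$). Define the type $a$ transform $$\hat f_a(z)=(-1)^a\int_{[0,1]}\varphi_a^*(\xi;z)f(\xi)\,dg(\xi),$$ and let $\nu_a=\sum_{z\in\sigma_a}\delta_z$ be the counting measure on the spectrum. (1) Let $a\in\{0,1,2\}$, and suppose that $g$ is nondegenerate or that $a=2$. Then $\sigma_a$ is finite, $(\varphi_a^*(z),\varphi(z))_g\ne0$ for $z\in\sigma_a$, and the transform $f\mapsto \hat f_a|_{\sigma_a}$ from $L^2_g$ to functions on $\sigma_a$ has the (two-sided) inverse $$F\longmapsto (-1)^a\int F(z)\,\frac{\varphi(\xi;z)}{(\varphi_a^*(z),\varphi(z))_g}\,d\nu_a(z).$$ In particular, for every $f\in L^2_g$ and $g$-almost every $\xi$ (that is, at every $\xi_i$), $$f(\xi)=(-1)^a\int \hat f_a(z)\,\frac{\varphi(\xi;z)}{(\varphi_a^*(z),\varphi(z))_g}\,d\nu_a(z).$$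 (2) In the degenerate as well as in the nondegenerate case, for every $z\in\sigma_2$ we have $\varphi_\xi(1;z)\neq0$ and $b(z):=-\varphi_\xi(1;z)/\partial_z\varphi_{\xi\xi}(1;z)>0$. With $\beta=\sum_{z\in\sigma_2}b(z)\,\delta_z$, the inverse of the type $2$ transform is also given by $$F\longmapsto\int F(z)\,\frac{\varphi(\xi;z)}{\varphi_\xi(1;z)}\,d\beta(z);$$ in particular, for every $f\in L^2_g$ and $g$-almost every $\xi$, $$f(\xi)=\int \hat f_2(z)\,\frac{\varphi(\xi;z)}{\varphi_\xi(1;z)}\,d\beta(z).$$ -/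

import Mathlib

open MeasureTheory Set
open scoped ENNReal

noncomputable section

namespace CubicString

/-- A discrete mass distribution `∑ i, mass i • δ_{pos i}` on the string `[0, 1]`, with positive
masses at points `0 < pos 0 < pos 1 < ⋯ ≤ 1`. The last mass may sit at the right end `1`
(the degenerate case). -/
structure DiscreteString (n : ℕ) where
  pos : Fin n → ℝ
  mass : Fin n → ℝ
  pos_strictMono : StrictMono pos
  pos_pos : ∀ i, 0 < pos i
  pos_le_one : ∀ i, pos i ≤ 1
  mass_pos : ∀ i, 0 < mass i

/-- All masses lie in the open interval `(0, 1)`. -/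
def DiscreteString.Nondegenerate {n : ℕ} (S : DiscreteString n) : Prop :=
  ∀ i, S.pos i < 1

/-- The mass measure `g = ∑ i, g_i δ_{ξ_i}`. -/
def DiscreteString.g {n : ℕ} (S : DiscreteString n) : Measure ℝ :=
  ∑ i, ENNReal.ofReal (S.mass i) • Measure.dirac (S.pos i)

/-- `U = (u, u_ξ, u_ξξ)` solves the equation `u_ξξξ = w g u` on `[0, 1]`, where `g` is a measure:
`u` is differentiable with derivative `u_ξ`, the function `u_ξ` is absolutely continuous with
density `u_ξξ`, and `d u_ξξ = w u dg`, where `u_ξξ` is the right-continuous representative.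
In particular, if `g` has an atom at `1`, then `U 2 1` is the right-hand limit of `u_ξξ` at `1`,
i.e. the value just after the jump. -/
structure IsSolution (g : Measure ℝ) (w : ℂ) (U : Fin 3 → ℝ → ℂ) : Prop where
  deriv_zero : ∀ ξ ∈ Icc (0 : ℝ) 1, HasDerivWithinAt (U 0) (U 1 ξ) (Icc 0 1) ξ
  deriv_one : ∀ ξ ∈ Icc (0 : ℝ) 1, U 1 ξ = U 1 0 + ∫ t in (0 : ℝ)..ξ, U 2 t
  deriv_two : ∀ ξ ∈ Icc (0 : ℝ) 1, U 2 ξ = U 2 0 + w * ∫ t in Ioc 0 ξ, U 0 t ∂g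

/-! ### Existence of solutions of the initial value problems -/

theorem exists_triangular {n : ℕ} (r : Fin n → Fin n → Prop) (hr : WellFounded r)
    (A : Fin n → ℂ) (K : Fin n → Fin n → ℂ) (hK : ∀ i j, ¬ r j i → K i j = 0) :
    ∃ c : Fin n → ℂ, ∀ i, c i = A i + ∑ j, K i j * c j := by
  classical
  let F : (i : Fin n) → ((j : Fin n) → r j i → ℂ) → ℂ :=
    fun i rec => A i + ∑ j, if h : r j i then K i j * rec j h else 0
  refine ⟨hr.fix F, fun i => ?_⟩
  rw [hr.fix_eq]
  simp only [F]
  congr 1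
  refine Finset.sum_congr rfl fun j _ => ?_
  split_ifs with h
  · rfl
  · rw [hK i j h, zero_mul]

theorem hasDerivAt_ramp (x ξ : ℝ) :
    HasDerivAt (fun t : ℝ => (max (t - x) 0) ^ 2 / 2) (max (ξ - x) 0) ξ := by
  rcases lt_trichotomy ξ x with h | h | h
  · rw [max_eq_right (by linarith)]
    refine (hasDerivAt_const ξ (0 : ℝ)).congr_of_eventuallyEq ?_
    filter_upwards [Iio_mem_nhds h] with t ht
    rw [max_eq_right (by linarith [show t < x from ht])]
    simp
  · subst h
    rw [sub_self, max_self, hasDerivAt_iff_isLittleO]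
    simp only [sub_self, max_self, smul_zero, sub_zero]
    have h1 : (fun t : ℝ => (max (t - ξ) 0) ^ 2 / 2 - 0 ^ 2 / 2) =O[nhds ξ]
        fun t => (t - ξ) ^ 2 := by
      refine Asymptotics.IsBigO.of_bound 1 (Filter.Eventually.of_forall fun t => ?_)
      rw [zero_pow two_ne_zero, zero_div, sub_zero, Real.norm_eq_abs, Real.norm_eq_abs, abs_of_nonneg (by positivity),
        abs_of_nonneg (by positivity)]
      rcases max_cases (t - ξ) 0 with ⟨h, _⟩ | ⟨h, _⟩ <;> rw [h] <;> nlinarith [sq_nonneg (t - ξ)]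
    refine h1.trans_isLittleO ?_
    have h2 : (fun t : ℝ => (t - ξ) ^ 2) = (fun s : ℝ => s ^ 2) ∘ fun t => t - ξ := rfl
    have h3 : (fun t : ℝ => t - ξ) = (fun s : ℝ => s) ∘ fun t => t - ξ := rfl
    rw [h2, h3]
    have h4 : (fun s : ℝ => s ^ 2) =o[nhds 0] fun s : ℝ => s := by
      simpa using Asymptotics.isLittleO_pow_pow (𝕜 := ℝ) (m := 1) (n := 2) (by norm_num)
    refine h4.comp_tendsto ?_
    have : Continuous fun t : ℝ => t - ξ := by fun_prop
    simpa [Function.comp_def] using this.tendsto ξ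
  · rw [max_eq_left (by linarith)]
    have h1 : HasDerivAt (fun t : ℝ => (t - x) ^ 2 / 2) (ξ - x) ξ := by
      have := (((hasDerivAt_id ξ).sub_const x).pow 2).div_const 2
      refine this.congr_deriv ?_
      simp
    refine h1.congr_of_eventuallyEq ?_
    filter_upwards [Ioi_mem_nhds h] with t ht
    rw [max_eq_left (by linarith [show x < t from ht])]

theorem integral_step {x ξ : ℝ} (hx : 0 < x) (hξ : 0 ≤ ξ) :
    (∫ t in (0 : ℝ)..ξ, (if x ≤ t then (1 : ℂ) else 0)) = ((max (ξ - x) 0 : ℝ) : ℂ) := by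
  rw [intervalIntegral.integral_of_le hξ]
  have h1 : (fun t : ℝ => if x ≤ t then (1 : ℂ) else 0) = (Ici x).indicator fun _ => (1 : ℂ) := by
    ext t; simp [indicator]
  rw [h1, setIntegral_indicator measurableSet_Ici]
  have h2 : Ioc 0 ξ ∩ Ici x = Icc x ξ := by
    ext t
    simp only [mem_inter_iff, mem_Ioc, mem_Ici, mem_Icc]
    constructor
    · rintro ⟨⟨_, h⟩, h'⟩; exact ⟨h', h⟩
    · rintro ⟨h, h'⟩; exact ⟨⟨by linarith, h'⟩, h⟩
  rw [h2]
  simp [Measure.real, Real.volume_Icc, ENNReal.toReal_ofReal']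

theorem DiscreteString.setIntegral_g {n : ℕ} (S : DiscreteString n) (f : ℝ → ℂ) {s : Set ℝ}
    (hs : MeasurableSet s) :
    (∫ t in s, f t ∂S.g) =
      ∑ i, (S.mass i : ℂ) * (open Classical in if S.pos i ∈ s then f (S.pos i) else 0) := by
  classical
  rw [← integral_indicator hs, DiscreteString.g, integral_finsetSum_measure]
  · refine Finset.sum_congr rfl fun i _ => ?_
    rw [integral_smul_measure, integral_dirac, ENNReal.toReal_ofReal (S.mass_pos i).le,
      indicator_apply]
    simp
  · intro i _
    exact (integrable_dirac (by simp)).smul_measure ENNReal.ofReal_ne_top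

theorem DiscreteString.isSolution_of_coeff {n : ℕ} (S : DiscreteString n) (w p q r : ℂ)
    (c : Fin n → ℂ)
    (hc : ∀ i, c i = p + q * S.pos i + r * (S.pos i) ^ 2 / 2 +
      ∑ j, w * S.mass j * c j * (((max (S.pos i - S.pos j) 0) ^ 2 / 2 : ℝ) : ℂ)) :
    IsSolution S.g w
      ![fun ξ => p + q * ξ + r * (ξ : ℂ) ^ 2 / 2 +
          ∑ j, w * S.mass j * c j * (((max (ξ - S.pos j) 0) ^ 2 / 2 : ℝ) : ℂ),
        fun ξ => q + r * ξ + ∑ j, w * S.mass j * c j * ((max (ξ - S.pos j) 0 : ℝ) : ℂ),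
        fun ξ => r + ∑ j, w * S.mass j * c j * (if S.pos j ≤ ξ then (1 : ℂ) else 0)] where
  deriv_zero := by
    intro ξ _
    refine HasDerivAt.hasDerivWithinAt ?_
    simp only [Matrix.cons_val_zero, Matrix.cons_val_one]
    refine HasDerivAt.add ?_ ?_
    · have h1 : HasDerivAt (fun t : ℝ => (t : ℂ)) 1 ξ := Complex.ofRealCLM.hasDerivAt
      have h2 := ((h1.const_mul q).const_add p).fun_add
        (((h1.fun_pow 2).const_mul r).div_const 2)
      convert h2 using 1
      simp only [Nat.cast_ofNat, Nat.add_one_sub_one, pow_one, mul_one]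
      ring
    · exact HasDerivAt.fun_sum fun j _ =>
        ((hasDerivAt_ramp (S.pos j) ξ).ofReal_comp).const_mul _
  deriv_one := by
    intro ξ hξ
    have hint : ∀ j, IntervalIntegrable
        (fun t : ℝ => w * S.mass j * c j * (if S.pos j ≤ t then (1 : ℂ) else 0)) volume 0 ξ := by
      intro j
      refine IntervalIntegrable.const_mul ?_ _
      have h1 : (fun t : ℝ => if S.pos j ≤ t then (1 : ℂ) else 0) =
          (Ici (S.pos j)).indicator fun _ => (1 : ℂ) := by
        ext t; simp [indicator]
      rw [h1, intervalIntegrable_iff]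
      exact (intervalIntegrable_iff.1 intervalIntegrable_const).indicator measurableSet_Ici
    simp only [Matrix.cons_val_one, Matrix.cons_val]
    rw [intervalIntegral.integral_add (by simp)
      (by simpa [Finset.sum_fn] using IntervalIntegrable.sum Finset.univ fun j _ => hint j),
      intervalIntegral.integral_finsetSum fun j _ => hint j]
    simp only [intervalIntegral.integral_const_mul, integral_step (S.pos_pos _) hξ.1]
    have h0 : ∀ j, max (-S.pos j) 0 = 0 := fun j =>
      max_eq_right (by linarith [S.pos_pos j])
    simp [h0]
    ring
  deriv_two := by
    intro ξ hξ
    simp only [Matrix.cons_val_zero, Matrix.cons_val]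
    rw [S.setIntegral_g _ measurableSet_Ioc]
    have h0 : ∀ j, ¬ S.pos j ≤ 0 := fun j => not_le.2 (S.pos_pos j)
    simp only [h0, if_false, mul_zero, Finset.sum_const_zero, add_zero, Finset.mul_sum]
    congr 1
    refine Finset.sum_congr rfl fun j _ => ?_
    rw [← hc j]
    by_cases h : S.pos j ≤ ξ
    · simp [h, S.pos_pos j]; ring
    · simp [h]

theorem DiscreteString.exists_solution_left {n : ℕ} (S : DiscreteString n) (w : ℂ)
    (v : Fin 3 → ℂ) : ∃ U, IsSolution S.g w U ∧ ∀ k, U k 0 = v k := by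
  obtain ⟨c, hc⟩ := exists_triangular (fun i j : Fin n => i < j) wellFounded_lt
    (fun i => v 0 + v 1 * S.pos i + v 2 * (S.pos i) ^ 2 / 2)
    (fun i j => w * S.mass j * (((max (S.pos i - S.pos j) 0) ^ 2 / 2 : ℝ) : ℂ)) (by
      intro i j hij
      rw [max_eq_right (by linarith [S.pos_strictMono.monotone (not_lt.1 hij)])]
      simp)
  refine ⟨_, S.isSolution_of_coeff w (v 0) (v 1) (v 2) c fun i => ?_, fun k => ?_⟩
  · rw [hc i]
    congr 1
    exact Finset.sum_congr rfl fun j _ => by ring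
  · have h0 : ∀ j, max (-S.pos j) 0 = 0 := fun j =>
      max_eq_right (by linarith [S.pos_pos j])
    have h1 : ∀ j, ¬ S.pos j ≤ 0 := fun j => not_le.2 (S.pos_pos j)
    fin_cases k <;> simp [h0, h1]

theorem DiscreteString.exists_solution_right {n : ℕ} (S : DiscreteString n) (w : ℂ)
    (v : Fin 3 → ℂ) : ∃ U, IsSolution S.g w U ∧ ∀ k, U k 1 = v k := by
  have key : ∀ t : ℝ, (max t 0) ^ 2 / 2 = t ^ 2 / 2 - (max (-t) 0) ^ 2 / 2 := by
    intro t
    rcases le_total t 0 with h | h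
    · rw [max_eq_right h, max_eq_left (by linarith)]; ring
    · rw [max_eq_left h, max_eq_right (by linarith)]; ring
  obtain ⟨c, hc⟩ := exists_triangular (fun i j : Fin n => i > j) wellFounded_gt
    (fun i => v 0 + v 1 * (S.pos i - 1) + v 2 * (S.pos i - 1) ^ 2 / 2)
    (fun i j => -(w * S.mass j * (((max (-(S.pos i - S.pos j)) 0) ^ 2 / 2 : ℝ) : ℂ))) (by
      intro i j hij
      rw [max_eq_right (by linarith [S.pos_strictMono.monotone (not_lt.1 hij)])]
      simp)
  have expand : ∀ ξ : ℝ, (v 0 - v 1 + v 2 / 2 - ∑ j, w * S.mass j * c j * (S.pos j : ℂ) ^ 2 / 2) +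
      (v 1 - v 2 + ∑ j, w * S.mass j * c j * S.pos j) * (ξ : ℂ) +
      (v 2 - ∑ j, w * S.mass j * c j) * (ξ : ℂ) ^ 2 / 2 =
      v 0 + v 1 * (ξ - 1) + v 2 * (ξ - 1) ^ 2 / 2 -
        ∑ j, w * S.mass j * c j * ((ξ - S.pos j) ^ 2 / 2) := by
    intro ξ
    have : ∑ j, w * S.mass j * c j * ((ξ - S.pos j) ^ 2 / 2 : ℂ) =
        (∑ j, w * S.mass j * c j * (S.pos j : ℂ) ^ 2 / 2) -
        (∑ j, w * S.mass j * c j * S.pos j) * ξ + (∑ j, w * S.mass j * c j) * (ξ : ℂ) ^ 2 / 2 := by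
      rw [Finset.sum_mul, Finset.sum_mul, Finset.sum_div, ← Finset.sum_sub_distrib,
        ← Finset.sum_add_distrib]
      exact Finset.sum_congr rfl fun j _ => by ring
    rw [this]
    ring
  refine ⟨_, S.isSolution_of_coeff w
    (v 0 - v 1 + v 2 / 2 - ∑ j, w * S.mass j * c j * (S.pos j : ℂ) ^ 2 / 2)
    (v 1 - v 2 + ∑ j, w * S.mass j * c j * S.pos j)
    (v 2 - ∑ j, w * S.mass j * c j) c fun i => ?_, fun k => ?_⟩
  · rw [expand, sub_add, ← Finset.sum_sub_distrib, hc i,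
      sub_eq_add_neg _ (Finset.sum _ _), ← Finset.sum_neg_distrib]
    congr 1
    refine Finset.sum_congr rfl fun j _ => ?_
    rw [key (S.pos i - S.pos j)]
    push_cast
    ring
  · have h0 : ∀ j, max (1 - S.pos j) 0 = 1 - S.pos j := fun j =>
      max_eq_left (by linarith [S.pos_le_one j])
    have h1 : ∀ j, S.pos j ≤ 1 := S.pos_le_one
    fin_cases k
    · have := expand 1
      simp only [Fin.zero_eta, Matrix.cons_val_zero, this, h0]
      push_cast
      simp
    · simp only [Fin.mk_one, Matrix.cons_val_one, Matrix.cons_val_zero, h0]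
      push_cast
      simp only [mul_sub, Finset.sum_sub_distrib, mul_one]
      ring
    · simp [h1]

/-! ### The string, its adjoint and the spectra -/

variable {n : ℕ} (S : DiscreteString n)

/-- `S.phi z = (φ, φ_ξ, φ_ξξ)(· ; z)`, where `φ` is the solution of the initial value problem
`-φ_ξξξ = z g φ`, `φ(0) = φ_ξ(0) = 0`, `φ_ξξ(0) = 1`. -/
def DiscreteString.phi (z : ℂ) : Fin 3 → ℝ → ℂ :=
  (S.exists_solution_left (-z) ![0, 0, 1]).choose

theorem DiscreteString.phi_spec (z : ℂ) :
    IsSolution S.g (-z) (S.phi z) ∧ ∀ k, S.phi z k 0 = (![0, 0, 1] : Fin 3 → ℂ) k :=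
  (S.exists_solution_left (-z) ![0, 0, 1]).choose_spec

/-- The vector `(φ*(1), φ*_ξ(1), φ*_ξξ(1))` of the adjoint initial value problem of type `a`. -/
def adjointInitial (a : Fin 3) : Fin 3 → ℂ :=
  ![![0, 0, 1], ![0, 1, 0], ![1, 0, 0]] a

/-- `S.phiStar a z = (φ*_a, φ*_{a,ξ}, φ*_{a,ξξ})(· ; z)`, where `φ*_a` is the solution of the
adjoint initial value problem of type `a`: `φ*_ξξξ = z g φ*` with data at `1`. -/
def DiscreteString.phiStar (a : Fin 3) (z : ℂ) : Fin 3 → ℝ → ℂ :=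
  (S.exists_solution_right z (adjointInitial a)).choose

theorem DiscreteString.phiStar_spec (a : Fin 3) (z : ℂ) :
    IsSolution S.g z (S.phiStar a z) ∧ ∀ k, S.phiStar a z k 1 = adjointInitial a k :=
  (S.exists_solution_right z (adjointInitial a)).choose_spec

/-- The spectrum of type `a`: all complex `z` for which the boundary value problem
`-u_ξξξ = z g u`, `u(0) = u_ξ(0) = 0`, with `u(1) = 0` (type `0`), `u_ξ(1) = 0` (type `1`) or
`u_ξξ(1) = 0` (type `2`), has a nontrivial solution. -/
def DiscreteString.spectrum (a : Fin 3) : Set ℂ :=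
  {z | ∃ U, IsSolution S.g (-z) U ∧ U 0 0 = 0 ∧ U 1 0 = 0 ∧ U a 1 = 0 ∧
    ∃ ξ ∈ Icc (0 : ℝ) 1, U 0 ξ ≠ 0}

/-- The symmetric bilinear form `(f, h)_g = ∫₀¹ f h dg`. -/
def DiscreteString.pairing (f h : ℝ → ℂ) : ℂ :=
  ∫ ξ in Icc (0 : ℝ) 1, f ξ * h ξ ∂S.g

/-- The generalized Fourier transform of type `a`. -/
def DiscreteString.fourier (a : Fin 3) (f : ℝ → ℂ) (z : ℂ) : ℂ :=
  (-1) ^ (a : ℕ) * ∫ ξ in Icc (0 : ℝ) 1, S.phiStar a z 0 ξ * f ξ ∂S.g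

/-- The measure `ν_a = ∑ δ_z`, the sum running over the spectrum of type `a`. -/
def DiscreteString.nu (a : Fin 3) : Measure ℂ :=
  Measure.sum fun z : S.spectrum a => Measure.dirac (z : ℂ)

/-- `b(z) = -φ_ξ(1; z) / φ_{ξξz}(1; z)`. -/
def DiscreteString.weight (z : ℂ) : ℂ :=
  -(S.phi z 1 1) / deriv (fun s : ℂ => S.phi s 2 1) z

/-- The measure `β = ∑ b(z) δ_z`, the sum running over the spectrum of type `2`. (The numbers
`b(z)` are positive there.) -/
def DiscreteString.beta : Measure ℂ :=
  Measure.sum fun z : S.spectrum 2 =>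
    ENNReal.ofReal (S.weight z).re • Measure.dirac (z : ℂ)

/-- `ξ ↦ (-1)^a ∫ F(z) φ(ξ; z) / (φ*_a(z), φ(z))_g dν_a(z)`. -/
def DiscreteString.invFourier (a : Fin 3) (F : ℂ → ℂ) (ξ : ℝ) : ℂ :=
  (-1) ^ (a : ℕ) *
    ∫ z, F z * (S.phi z 0 ξ / S.pairing (S.phiStar a z 0) (S.phi z 0)) ∂S.nu a

/-- `ξ ↦ ∫ F(z) φ(ξ; z) / φ_ξ(1; z) dβ(z)`. -/
def DiscreteString.invFourierBeta (F : ℂ → ℂ) (ξ : ℝ) : ℂ :=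
  ∫ z, F z * (S.phi z 0 ξ / S.phi z 1 1) ∂S.beta

end CubicString

end

namespace CubicString

open Polynomial

/-! ### Explicit form of the solutions -/

section Solutions

variable {n : ℕ} {S : DiscreteString n} {w : ℂ} {U : Fin 3 → ℝ → ℂ}

/-! The masses sit at finitely many points, so `φ` has an explicit form and `φ^(a)(1; z) = P_a(-z)`
for a real polynomial `P_a = S.charPoly a`; the spectrum is its zero set up to sign. The Lagrange
identity `pairing_mul_sub'` reads `(z' - z) (φ*_a(z'), φ(z))_g = (-1)^a (P_a(-z) - P_a(-z'))`. On
the spectrum it gives biorthogonality, and on the diagonal, in the limit, `(φ*_a(z), φ(z))_g =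
(-1)^a P_a'(-z)`.

What remains is that `P_a` has exactly `n` distinct zeros, for then transform and inverse are square
matrices and a one-sided inverse suffices. The degree is read off the transfer recursion. Reality
and simplicity of the zeros come from one positivity argument: the triple `(φ, φ_ξ, φ_ξξ)`, mapped
to the plane, keeps a cyclic order along the string (`Interlaced`). Mapping `f` to `(Re f(x), Im
f(x))` with `Im x > 0` excludes nonreal zeros; mapping `f` to `(f(x), f'(x))` with `x` real gives
positive Wronskians, hence simple zeros, and also the sign of `b(z)`. -/

theorem IsSolution.two_eq (h : IsSolution S.g w U) {ξ : ℝ} (hξ : ξ ∈ Icc (0 : ℝ) 1) :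
    U 2 ξ = U 2 0 +
      ∑ j, w * S.mass j * U 0 (S.pos j) * (if S.pos j ≤ ξ then (1 : ℂ) else 0) := by
  rw [h.deriv_two ξ hξ, S.setIntegral_g _ measurableSet_Ioc, Finset.mul_sum]
  congr 1
  refine Finset.sum_congr rfl fun j _ => ?_
  by_cases hj : S.pos j ≤ ξ
  · simp [hj, S.pos_pos j, mul_assoc]
  · simp [hj]

theorem IsSolution.one_eq (h : IsSolution S.g w U) {ξ : ℝ} (hξ : ξ ∈ Icc (0 : ℝ) 1) :
    U 1 ξ = U 1 0 + U 2 0 * ξ +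
      ∑ j, w * S.mass j * U 0 (S.pos j) * ((max (ξ - S.pos j) 0 : ℝ) : ℂ) := by
  have hint : ∀ j, IntervalIntegrable (fun t : ℝ =>
      w * S.mass j * U 0 (S.pos j) * (if S.pos j ≤ t then (1 : ℂ) else 0)) volume 0 ξ := by
    intro j
    refine IntervalIntegrable.const_mul ?_ _
    have h1 : (fun t : ℝ => if S.pos j ≤ t then (1 : ℂ) else 0) =
        (Ici (S.pos j)).indicator fun _ => (1 : ℂ) := by
      ext t; simp [indicator]
    rw [h1, intervalIntegrable_iff]
    exact (intervalIntegrable_iff.1 intervalIntegrable_const).indicator measurableSet_Ici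
  have hcongr : ∫ t in (0 : ℝ)..ξ, U 2 t = ∫ t in (0 : ℝ)..ξ, (U 2 0 +
      ∑ j, w * S.mass j * U 0 (S.pos j) * (if S.pos j ≤ t then (1 : ℂ) else 0)) := by
    refine intervalIntegral.integral_congr fun t ht => ?_
    rw [uIcc_of_le hξ.1] at ht
    exact h.two_eq ⟨ht.1, ht.2.trans hξ.2⟩
  rw [h.deriv_one ξ hξ, hcongr, intervalIntegral.integral_add (by simp)
    (by simpa [Finset.sum_fn] using IntervalIntegrable.sum Finset.univ fun j _ => hint j),
    intervalIntegral.integral_finsetSum fun j _ => hint j]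
  simp only [intervalIntegral.integral_const_mul, integral_step (S.pos_pos _) hξ.1]
  simp
  ring

/-- By `one_eq`, `U 0` and the ramp expression `V` have the same derivative on `[0, 1]`, so they
differ by a constant. The solution is thus determined by its data at `0` and its values at the
masses. -/
theorem IsSolution.zero_eq (h : IsSolution S.g w U) {ξ : ℝ} (hξ : ξ ∈ Icc (0 : ℝ) 1) :
    U 0 ξ = U 0 0 + U 1 0 * ξ + U 2 0 * (ξ : ℂ) ^ 2 / 2 +
      ∑ j, w * S.mass j * U 0 (S.pos j) * (((max (ξ - S.pos j) 0) ^ 2 / 2 : ℝ) : ℂ) := by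
  set V : ℝ → ℂ := fun ξ => U 1 0 * ξ + U 2 0 * (ξ : ℂ) ^ 2 / 2 +
      ∑ j, w * S.mass j * U 0 (S.pos j) * (((max (ξ - S.pos j) 0) ^ 2 / 2 : ℝ) : ℂ) with hV
  have hder : ∀ x ∈ Icc (0 : ℝ) 1, HasDerivWithinAt (fun t => U 0 t - V t) 0 (Icc 0 1) x := by
    intro x hx
    have h1 : HasDerivAt (fun t : ℝ => (t : ℂ)) 1 x := Complex.ofRealCLM.hasDerivAt
    have h2 := (h1.const_mul (U 1 0)).fun_add (((h1.fun_pow 2).const_mul (U 2 0)).div_const 2)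
    have h3 := h2.fun_add (HasDerivAt.fun_sum (u := Finset.univ) fun j _ =>
      ((hasDerivAt_ramp (S.pos j) x).ofReal_comp).const_mul (w * S.mass j * U 0 (S.pos j)))
    have h4 := (h.deriv_zero x hx).fun_sub h3.hasDerivWithinAt
    refine h4.congr_deriv ?_
    rw [h.one_eq hx]
    simp only [Nat.cast_ofNat, Nat.add_one_sub_one, pow_one, mul_one]
    ring
  have hconst := constant_of_has_deriv_right_zero (fun x hx => (hder x hx).continuousWithinAt)
    (fun x hx => (hder x (Ico_subset_Icc_self hx)).mono_of_mem_nhdsWithin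
      (Icc_mem_nhdsGE_of_mem hx)) ξ hξ
  have h0 : ∀ j, max (-S.pos j) 0 = 0 := fun j => max_eq_right (by linarith [S.pos_pos j])
  have hV0 : V 0 = 0 := by simp [hV, h0]
  simp only [hV0, sub_zero] at hconst
  rw [sub_eq_iff_eq_add.1 hconst, hV]
  ring

/-- Expansion about `1` instead of `0`, as the adjoint problem requires. The ramps are reflected by
`max t 0 ^ 2 = t ^ 2 - max (-t) 0 ^ 2`; the full squares recombine into the Taylor polynomial at
`1`. -/
theorem IsSolution.zero_eq_right (h : IsSolution S.g w U) {ξ : ℝ} (hξ : ξ ∈ Icc (0 : ℝ) 1) :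
    U 0 ξ = U 0 1 + U 1 1 * (ξ - 1) + U 2 1 * ((ξ : ℂ) - 1) ^ 2 / 2 -
      ∑ j, w * S.mass j * U 0 (S.pos j) * (((max (S.pos j - ξ) 0) ^ 2 / 2 : ℝ) : ℂ) := by
  have h1 : (1 : ℝ) ∈ Icc (0 : ℝ) 1 := by simp
  have hm : ∀ j, max (1 - S.pos j) 0 = 1 - S.pos j := fun j =>
    max_eq_left (by linarith [S.pos_le_one j])
  have hsum : ∑ j, w * S.mass j * U 0 (S.pos j) * (((max (ξ - S.pos j) 0) ^ 2 / 2 : ℝ) : ℂ) =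
      (∑ j, w * S.mass j * U 0 (S.pos j) * (((1 - S.pos j) ^ 2 / 2 : ℝ) : ℂ)) +
      (∑ j, w * S.mass j * U 0 (S.pos j) * ((1 - S.pos j : ℝ) : ℂ)) * (ξ - 1) +
      (∑ j, w * S.mass j * U 0 (S.pos j)) * (((ξ : ℂ) - 1) ^ 2 / 2) -
      ∑ j, w * S.mass j * U 0 (S.pos j) * (((max (S.pos j - ξ) 0) ^ 2 / 2 : ℝ) : ℂ) := by
    rw [Finset.sum_mul, Finset.sum_mul, ← Finset.sum_add_distrib, ← Finset.sum_add_distrib,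
      ← Finset.sum_sub_distrib]
    refine Finset.sum_congr rfl fun j _ => ?_
    rcases le_total ξ (S.pos j) with hj | hj
    · rw [max_eq_right (sub_nonpos.2 hj), max_eq_left (sub_nonneg.2 hj)]
      push_cast
      ring
    · rw [max_eq_left (sub_nonneg.2 hj), max_eq_right (sub_nonpos.2 hj)]
      push_cast
      ring
  rw [h.zero_eq hξ, h.zero_eq h1, h.one_eq h1, h.two_eq h1, hsum]
  simp only [hm, S.pos_le_one, if_true, mul_one]
  push_cast
  ring

end Solutions

/-! ### Pairings and the Lagrange identity -/

variable {n : ℕ} (S : DiscreteString n)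

theorem DiscreteString.pos_mem (i : Fin n) : S.pos i ∈ Icc (0 : ℝ) 1 :=
  ⟨(S.pos_pos i).le, S.pos_le_one i⟩

theorem DiscreteString.integral_Icc_g (f : ℝ → ℂ) :
    ∫ ξ in Icc (0 : ℝ) 1, f ξ ∂S.g = ∑ i, (S.mass i : ℂ) * f (S.pos i) := by
  classical
  rw [S.setIntegral_g f measurableSet_Icc]
  exact Finset.sum_congr rfl fun i _ => by rw [if_pos (S.pos_mem i)]

/-- The polynomial `(ξ - 1)^(2 - a) / (2 - a)!` solving the adjoint problem of type `a` without
masses. -/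
noncomputable def adjointFree (a : Fin 3) (ξ : ℂ) : ℂ :=
  (![(ξ - 1) ^ 2 / 2, ξ - 1, 1] : Fin 3 → ℂ) a

theorem DiscreteString.phi_zero_eq (z : ℂ) {ξ : ℝ} (hξ : ξ ∈ Icc (0 : ℝ) 1) :
    S.phi z 0 ξ = (ξ : ℂ) ^ 2 / 2 - z * ∑ j, S.mass j * S.phi z 0 (S.pos j) *
      (((max (ξ - S.pos j) 0) ^ 2 / 2 : ℝ) : ℂ) := by
  obtain ⟨h, h0⟩ := S.phi_spec z
  rw [h.zero_eq hξ, h0, h0, h0, Finset.mul_sum, sub_eq_add_neg _ (Finset.sum _ _),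
    ← Finset.sum_neg_distrib]
  simp [mul_assoc]

theorem DiscreteString.phiStar_zero_eq (a : Fin 3) (z : ℂ) {ξ : ℝ} (hξ : ξ ∈ Icc (0 : ℝ) 1) :
    S.phiStar a z 0 ξ = adjointFree a ξ - z * ∑ j, S.mass j * S.phiStar a z 0 (S.pos j) *
      (((max (S.pos j - ξ) 0) ^ 2 / 2 : ℝ) : ℂ) := by
  obtain ⟨h, h0⟩ := S.phiStar_spec a z
  rw [h.zero_eq_right hξ, h0, h0, h0, Finset.mul_sum]
  simp only [mul_assoc]
  congr 1
  fin_cases a <;> simp [adjointFree, adjointInitial]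

/-- The `a`-th `ξ`-derivative of `(ξ - x)^2 / 2` at `ξ = 1` is `(-1)^a * adjointFree a x`, so the
end value of `φ` is written in terms of the adjoint problem. -/
theorem DiscreteString.phi_one_eq (a : Fin 3) (z : ℂ) :
    (-1) ^ (a : ℕ) * S.phi z a 1 = adjointFree a 0 -
      z * ∑ j, S.mass j * S.phi z 0 (S.pos j) * adjointFree a (S.pos j) := by
  obtain ⟨h, h0⟩ := S.phi_spec z
  have h1 : (1 : ℝ) ∈ Icc (0 : ℝ) 1 := by simp
  have hm : ∀ j, max (1 - S.pos j) 0 = 1 - S.pos j := fun j =>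
    max_eq_left (by linarith [S.pos_le_one j])
  have e0 := h.zero_eq h1
  have e1 := h.one_eq h1
  have e2 := h.two_eq h1
  simp only [h0, hm, S.pos_le_one, if_true] at e0 e1 e2
  rw [Finset.mul_sum]
  fin_cases a
  · simp only [Fin.zero_eta, e0, adjointFree, sub_eq_add_neg _ (Finset.sum _ _),
      ← Finset.sum_neg_distrib]
    simp
    refine Finset.sum_congr rfl fun j _ => by ring
  · simp only [Fin.mk_one, e1, adjointFree, sub_eq_add_neg _ (Finset.sum _ _),
      ← Finset.sum_neg_distrib]
    simp [← Finset.sum_neg_distrib]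
    rw [add_comm]
    congr 1
    refine Finset.sum_congr rfl fun j _ => by ring
  · simp only [Fin.reduceFinMk, e2, adjointFree, sub_eq_add_neg _ (Finset.sum _ _),
      ← Finset.sum_neg_distrib]
    simp
    simp only [mul_assoc]

/-- Replaces integration by parts: expanding `φ` (`e1`) or `φ*` (`e2`) in the same pairing produces
the same double sum with kernel `k`, with factors `z` and `z'`. It cancels in `z' * e1 - z * e2`. -/
theorem DiscreteString.pairing_mul_sub (a : Fin 3) (z z' : ℂ) :
    (z' - z) * S.pairing (S.phiStar a z' 0) (S.phi z 0) =
      (-1) ^ (a : ℕ) * S.phi z a 1 - S.phiStar a z' 0 0 := by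
  have h0 : (0 : ℝ) ∈ Icc (0 : ℝ) 1 := by simp
  set u : Fin n → ℂ := fun j => S.phi z 0 (S.pos j) with hu
  set v : Fin n → ℂ := fun j => S.phiStar a z' 0 (S.pos j) with hv
  set k : Fin n → Fin n → ℂ := fun i j => (((max (S.pos i - S.pos j) 0) ^ 2 / 2 : ℝ) : ℂ) with hk
  have hpair : S.pairing (S.phiStar a z' 0) (S.phi z 0) = ∑ i, S.mass i * (v i * u i) :=
    S.integral_Icc_g _
  have hstar : S.phiStar a z' 0 0 =
      adjointFree a 0 - z' * ∑ j, S.mass j * v j * ((S.pos j : ℂ) ^ 2 / 2) := by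
    rw [S.phiStar_zero_eq a z' h0]
    simp [hv, max_eq_left (S.pos_pos _).le]
  have hu' : ∀ i, u i = (S.pos i : ℂ) ^ 2 / 2 - z * ∑ j, S.mass j * u j * k i j :=
    fun i => S.phi_zero_eq z (S.pos_mem i)
  have hv' : ∀ j, v j = adjointFree a (S.pos j) - z' * ∑ i, S.mass i * v i * k i j :=
    fun j => S.phiStar_zero_eq a z' (S.pos_mem j)
  have e1 : ∑ i, S.mass i * (v i * u i) = ∑ i, S.mass i * v i * ((S.pos i : ℂ) ^ 2 / 2) -
      z * ∑ i, ∑ j, S.mass i * S.mass j * v i * u j * k i j := by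
    rw [Finset.mul_sum, ← Finset.sum_sub_distrib]
    refine Finset.sum_congr rfl fun i _ => ?_
    rw [hu' i]
    simp only [mul_sub, Finset.mul_sum]
    congr 1
    · ring
    · exact Finset.sum_congr rfl fun j _ => by ring
  have e2 : ∑ i, S.mass i * (v i * u i) = ∑ j, S.mass j * u j * adjointFree a (S.pos j) -
      z' * ∑ i, ∑ j, S.mass i * S.mass j * v i * u j * k i j := by
    rw [Finset.sum_comm (f := fun i j => (S.mass i * S.mass j * v i * u j * k i j : ℂ)),
      Finset.mul_sum, ← Finset.sum_sub_distrib]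
    refine Finset.sum_congr rfl fun j _ => ?_
    rw [hv' j]
    simp only [sub_mul, mul_sub, Finset.mul_sum, Finset.sum_mul]
    congr 1
    · ring
    · exact Finset.sum_congr rfl fun i _ => by ring
  rw [hpair, hstar, S.phi_one_eq]
  linear_combination z' * e1 - z * e2

theorem DiscreteString.pairing_mul_sub' (a : Fin 3) (z z' : ℂ) :
    (z' - z) * S.pairing (S.phiStar a z' 0) (S.phi z 0) =
      (-1) ^ (a : ℕ) * (S.phi z a 1 - S.phi z' a 1) := by
  -- The diagonal case identifies `φ*_a(0; z')` with `(-1)^a φ^(a)(1; z')`.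
  have h := S.pairing_mul_sub a z' z'
  rw [sub_self, zero_mul] at h
  rw [S.pairing_mul_sub]
  linear_combination -h

/-! ### Interlacing triples -/

/-- The determinant of two plane vectors. -/
def bracket (u v : ℝ × ℝ) : ℝ := u.1 * v.2 - u.2 * v.1

/-- The linear map of the plane with matrix `!![a, -b; c, a]`. -/
def planeMul (a b c : ℝ) (u : ℝ × ℝ) : ℝ × ℝ := (a * u.1 - b * u.2, c * u.1 + a * u.2)

/-- Strict cyclic ordering of `p, q, r, x p`, where `x` acts as `planeMul a b c`. -/
structure Interlaced (a b c : ℝ) (p q r : ℝ × ℝ) : Prop where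
  pq : 0 ≤ bracket p q
  pr : 0 < bracket p r
  qr : 0 < bracket q r
  rxp : 0 < bracket r (planeMul a b c p)
  rxq : 0 < bracket r (planeMul a b c q)

theorem bracket_planeMul_self_nonneg {a b c : ℝ} (hb : 0 ≤ b) (hc : 0 ≤ c) (p : ℝ × ℝ) :
    0 ≤ bracket p (planeMul a b c p) := by
  have : bracket p (planeMul a b c p) = c * p.1 ^ 2 + b * p.2 ^ 2 := by
    simp only [bracket, planeMul]; ring
  rw [this]
  positivity

/-- Massless motion over a length `l`: every new bracket is a combination of old ones with
nonnegative coefficients. -/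
theorem Interlaced.propagate {a b c : ℝ} {p q r : ℝ × ℝ} (hb : 0 ≤ b) (hc : 0 ≤ c)
    (h : Interlaced a b c p q r) {l : ℝ} (hl : 0 ≤ l) :
    Interlaced a b c (p + l • q + (l ^ 2 / 2) • r) (q + l • r) r := by
  obtain ⟨h1, h2, h3, h4, h5⟩ := h
  have h6 := bracket_planeMul_self_nonneg (a := a) hb hc r
  constructor
  · have : bracket (p + l • q + (l ^ 2 / 2) • r) (q + l • r) =
        bracket p q + l * bracket p r + l ^ 2 / 2 * bracket q r := by
      simp [bracket]; ring
    rw [this]; positivity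
  · have : bracket (p + l • q + (l ^ 2 / 2) • r) r = bracket p r + l * bracket q r := by
      simp [bracket]; ring
    rw [this]; positivity
  · have : bracket (q + l • r) r = bracket q r := by simp [bracket]; ring
    rwa [this]
  · have : bracket r (planeMul a b c (p + l • q + (l ^ 2 / 2) • r)) =
        bracket r (planeMul a b c p) + l * bracket r (planeMul a b c q) +
          l ^ 2 / 2 * bracket r (planeMul a b c r) := by
      simp [bracket, planeMul]; ring
    rw [this]; positivity
  · have : bracket r (planeMul a b c (q + l • r)) =
        bracket r (planeMul a b c q) + l * bracket r (planeMul a b c r) := by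
      simp [bracket, planeMul]; ring
    rw [this]; positivity

theorem Interlaced.jump {a b c : ℝ} {p q r : ℝ × ℝ} (hb : 0 ≤ b) (hc : 0 ≤ c)
    (h : Interlaced a b c p q r) {m : ℝ} (hm : 0 ≤ m) :
    Interlaced a b c p q (r + m • planeMul a b c p) := by
  obtain ⟨h1, h2, h3, h4, h5⟩ := h
  have h6 := bracket_planeMul_self_nonneg (a := a) hb hc p
  have h7 : 0 ≤ bracket q (planeMul a b c p) := by
    -- Plücker relation for `p, q, r, x p`; the factor `bracket p r` is positive and can be
    -- cancelled.
    have key : bracket p r * bracket q (planeMul a b c p) =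
        bracket p q * bracket r (planeMul a b c p) +
          bracket p (planeMul a b c p) * bracket q r := by
      simp only [bracket]; ring
    have : 0 ≤ bracket p r * bracket q (planeMul a b c p) := by rw [key]; positivity
    exact nonneg_of_mul_nonneg_right this h2
  refine ⟨h1, ?_, ?_, ?_, ?_⟩
  · have : bracket p (r + m • planeMul a b c p) =
        bracket p r + m * bracket p (planeMul a b c p) := by simp [bracket]; ring
    rw [this]; positivity
  · have : bracket q (r + m • planeMul a b c p) =
        bracket q r + m * bracket q (planeMul a b c p) := by simp [bracket]; ring
    rw [this]; positivity
  · have : bracket (r + m • planeMul a b c p) (planeMul a b c p) =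
        bracket r (planeMul a b c p) := by simp [bracket]; ring
    rwa [this]
  -- `a ^ 2 + b * c` is the determinant of `planeMul a b c`.
  · have : bracket (r + m • planeMul a b c p) (planeMul a b c q) =
        bracket r (planeMul a b c q) + m * ((a ^ 2 + b * c) * bracket p q) := by
      simp [bracket, planeMul]; ring
    rw [this]; positivity

/-- Before the first mass all three vectors are parallel and the strict inequalities fail; the first
mass, together with `c > 0`, separates them. -/
theorem interlaced_initial {a b c : ℝ} (hc : 0 < c) {l m : ℝ} (hl : 0 < l) (hm : 0 < m) :
    Interlaced a b c ((l ^ 2 / 2) • ((1, 0) : ℝ × ℝ)) (l • (1, 0))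
      ((1, 0) + m • planeMul a b c ((l ^ 2 / 2) • ((1, 0) : ℝ × ℝ))) := by
  constructor
  · simp [bracket]
  · have : 0 < l ^ 2 / 2 * (m * (c * (l ^ 2 / 2))) := by positivity
    simpa [bracket, planeMul] using this
  · have : 0 < l * (m * (c * (l ^ 2 / 2))) := by positivity
    simpa [bracket, planeMul] using this
  · have : 0 < c * (l ^ 2 / 2) := by positivity
    simp [bracket, planeMul]
    linarith
  · have : 0 < c * l := by positivity
    simp [bracket, planeMul]
    linarith

/-! ### The transfer recursion -/

/-- The points `0, ξ_1, …, ξ_n, 1, 1, …`. -/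
noncomputable def DiscreteString.node : ℕ → ℝ
  | 0 => 0
  | k + 1 => if h : k < n then S.pos ⟨k, h⟩ else 1

/-- The mass at `S.node (k + 1)`, with `0` past the last mass. -/
noncomputable def DiscreteString.nodeMass (k : ℕ) : ℝ :=
  if h : k < n then S.mass ⟨k, h⟩ else 0

theorem DiscreteString.nodeMass_nonneg (k : ℕ) : 0 ≤ S.nodeMass k := by
  unfold DiscreteString.nodeMass
  split_ifs with h
  · exact (S.mass_pos _).le
  · exact le_rfl

theorem DiscreteString.nodeMass_pos {k : ℕ} (hk : k < n) : 0 < S.nodeMass k := by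
  simpa [DiscreteString.nodeMass, hk] using S.mass_pos _

theorem DiscreteString.node_succ_of_lt {k : ℕ} (hk : k < n) : S.node (k + 1) = S.pos ⟨k, hk⟩ := by
  simp [DiscreteString.node, hk]

theorem DiscreteString.node_succ_of_le {k : ℕ} (hk : n ≤ k) : S.node (k + 1) = 1 := by
  simp [DiscreteString.node, hk.not_gt]

theorem DiscreteString.node_mem (k : ℕ) : S.node k ∈ Icc (0 : ℝ) 1 := by
  rcases k with _ | k
  · simp [DiscreteString.node]
  · rcases lt_or_ge k n with hk | hk
    · rw [S.node_succ_of_lt hk]; exact S.pos_mem _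
    · rw [S.node_succ_of_le hk]; simp

theorem DiscreteString.node_lt_succ {k : ℕ} (hk : k < n) : S.node k < S.node (k + 1) := by
  rw [S.node_succ_of_lt hk]
  rcases k with _ | k
  · exact S.pos_pos _
  · rw [S.node_succ_of_lt (k.lt_succ_self.trans hk)]
    exact S.pos_strictMono (by simp)

theorem DiscreteString.node_le_succ (k : ℕ) : S.node k ≤ S.node (k + 1) := by
  rcases lt_or_ge k n with hk | hk
  · exact (S.node_lt_succ hk).le
  · rw [S.node_succ_of_le hk]; exact (S.node_mem k).2

theorem DiscreteString.node_last_lt (hS : S.Nondegenerate) : S.node n < S.node (n + 1) := by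
  rw [S.node_succ_of_le le_rfl]
  rcases n with _ | n
  · simp [DiscreteString.node]
  · rw [S.node_succ_of_lt n.lt_succ_self]
    exact hS _

theorem DiscreteString.pos_le_node_iff (j : Fin n) (k : ℕ) :
    S.pos j ≤ S.node k ↔ (j : ℕ) < k := by
  rcases k with _ | k
  · simpa [DiscreteString.node] using S.pos_pos j
  · rcases lt_or_ge k n with hk | hk
    · rw [S.node_succ_of_lt hk, S.pos_strictMono.le_iff_le, Fin.le_def, Nat.lt_succ_iff]
    · rw [S.node_succ_of_le hk]
      simp only [S.pos_le_one j, true_iff]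
      omega

/-- No mass lies strictly between consecutive nodes, so there each ramp is either zero or of slope
one. -/
theorem DiscreteString.max_node_succ_sub (j : Fin n) (k : ℕ) :
    max (S.node (k + 1) - S.pos j) 0 = max (S.node k - S.pos j) 0 +
      (S.node (k + 1) - S.node k) * (if S.pos j ≤ S.node k then 1 else 0) := by
  by_cases h : (j : ℕ) < k
  · have h1 := (S.pos_le_node_iff j k).2 h
    have h2 := S.node_le_succ k
    rw [if_pos h1, max_eq_left (by linarith), max_eq_left (by linarith)]
    ring
  · have h1 : ¬ S.pos j ≤ S.node k := fun h' => h ((S.pos_le_node_iff j k).1 h')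
    have h2 : S.node (k + 1) ≤ S.pos j := by
      have hk : k < n := by omega
      rw [S.node_succ_of_lt hk]
      exact S.pos_strictMono.monotone (by rw [Fin.le_def]; simpa using h)
    rw [if_neg h1, max_eq_right (by linarith), max_eq_right (by linarith)]
    ring

section Transfer

variable {S} {w : ℂ} {U : Fin 3 → ℝ → ℂ}

theorem IsSolution.one_node_succ (h : IsSolution S.g w U) (k : ℕ) :
    U 1 (S.node (k + 1)) = U 1 (S.node k) +
      ((S.node (k + 1) - S.node k : ℝ) : ℂ) * U 2 (S.node k) := by
  rw [h.one_eq (S.node_mem (k + 1)), h.one_eq (S.node_mem k), h.two_eq (S.node_mem k)]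
  simp only [S.max_node_succ_sub, mul_add, Finset.mul_sum]
  push_cast
  simp only [mul_add, Finset.sum_add_distrib]
  have : ∑ j, w * S.mass j * U 0 (S.pos j) *
      (((S.node (k + 1) : ℂ) - S.node k) *
        ((if S.pos j ≤ S.node k then 1 else 0 : ℝ) : ℂ)) =
      ∑ j, ((S.node (k + 1) : ℂ) - S.node k) *
        (w * S.mass j * U 0 (S.pos j) * (if S.pos j ≤ S.node k then 1 else 0)) :=
    Finset.sum_congr rfl fun j _ => by split_ifs <;> push_cast <;> ring
  rw [this]
  ring

theorem IsSolution.zero_node_succ (h : IsSolution S.g w U) (k : ℕ) :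
    U 0 (S.node (k + 1)) = U 0 (S.node k) +
      ((S.node (k + 1) - S.node k : ℝ) : ℂ) * U 1 (S.node k) +
      (((S.node (k + 1) - S.node k) ^ 2 / 2 : ℝ) : ℂ) * U 2 (S.node k) := by
  rw [h.zero_eq (S.node_mem (k + 1)), h.zero_eq (S.node_mem k), h.one_eq (S.node_mem k),
    h.two_eq (S.node_mem k)]
  set l := S.node (k + 1) - S.node k with hl
  have key : ∀ j, max (S.node (k + 1) - S.pos j) 0 ^ 2 / 2 = max (S.node k - S.pos j) 0 ^ 2 / 2 +
      l * max (S.node k - S.pos j) 0 + l ^ 2 / 2 * (if S.pos j ≤ S.node k then 1 else 0) := by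
    intro j
    rw [S.max_node_succ_sub]
    split_ifs with hj
    · ring
    · rw [max_eq_right (by linarith)]; ring
  have hsum : ∑ j, w * S.mass j * U 0 (S.pos j) *
      ((max (S.node (k + 1) - S.pos j) 0 ^ 2 / 2 : ℝ) : ℂ) =
      ∑ j, w * S.mass j * U 0 (S.pos j) * ((max (S.node k - S.pos j) 0 ^ 2 / 2 : ℝ) : ℂ) +
      (l : ℂ) * ∑ j, w * S.mass j * U 0 (S.pos j) * ((max (S.node k - S.pos j) 0 : ℝ) : ℂ) +
      ((l ^ 2 / 2 : ℝ) : ℂ) * ∑ j, w * S.mass j * U 0 (S.pos j) *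
        (if S.pos j ≤ S.node k then (1 : ℂ) else 0) := by
    rw [Finset.mul_sum, Finset.mul_sum, ← Finset.sum_add_distrib, ← Finset.sum_add_distrib]
    refine Finset.sum_congr rfl fun j _ => ?_
    rw [key j]
    split_ifs <;> push_cast <;> ring
  rw [hsum, show S.node (k + 1) = S.node k + l by rw [hl]; ring]
  push_cast
  ring

theorem IsSolution.two_node_succ (h : IsSolution S.g w U) (k : ℕ) :
    U 2 (S.node (k + 1)) = U 2 (S.node k) + w * S.nodeMass k * U 0 (S.node (k + 1)) := by
  rw [h.two_eq (S.node_mem (k + 1)), h.two_eq (S.node_mem k), add_assoc]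
  congr 1
  simp only [S.pos_le_node_iff]
  rcases lt_or_ge k n with hk | hk
  · rw [← sub_eq_iff_eq_add', ← Finset.sum_sub_distrib,
      Finset.sum_eq_single (⟨k, hk⟩ : Fin n)]
    · simp [DiscreteString.nodeMass, hk, S.node_succ_of_lt hk]
    · intro j _ hj
      have : (j : ℕ) < k + 1 ↔ (j : ℕ) < k := by
        have : (j : ℕ) ≠ k := fun h' => hj (Fin.ext h')
        omega
      simp [this]
    · simp
  · have h1 : ∀ j : Fin n, (j : ℕ) < k + 1 := fun j => by omega
    have h2 : ∀ j : Fin n, (j : ℕ) < k := fun j => by omega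
    simp [h1, h2, DiscreteString.nodeMass, hk.not_gt]

end Transfer

/-- `S.state k` consists of the values of `φ, φ_ξ, φ_ξξ` at `S.node k` as polynomials
in `-z`. -/
noncomputable def DiscreteString.state : ℕ → Fin 3 → ℝ[X]
  | 0 => ![0, 0, 1]
  | k + 1 =>
    let l := S.node (k + 1) - S.node k
    let s := DiscreteString.state k
    let p := s 0 + C l * s 1 + C (l ^ 2 / 2) * s 2
    ![p, s 1 + C l * s 2, s 2 + C (S.nodeMass k) * (X * p)]

theorem DiscreteString.state_succ_zero (k : ℕ) : S.state (k + 1) 0 = S.state k 0 +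
    C (S.node (k + 1) - S.node k) * S.state k 1 +
    C ((S.node (k + 1) - S.node k) ^ 2 / 2) * S.state k 2 := rfl

theorem DiscreteString.state_succ_one (k : ℕ) : S.state (k + 1) 1 = S.state k 1 +
    C (S.node (k + 1) - S.node k) * S.state k 2 := rfl

theorem DiscreteString.state_succ_two (k : ℕ) : S.state (k + 1) 2 = S.state k 2 +
    C (S.nodeMass k) * (X * S.state (k + 1) 0) := rfl

/-- The polynomial `P` with `φ^(a)(1; z) = P(-z)`. -/
noncomputable def DiscreteString.charPoly (a : Fin 3) : ℝ[X] := S.state (n + 1) a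

variable {S} in
theorem IsSolution.eq_aeval_state {w : ℂ} {U : Fin 3 → ℝ → ℂ} (h : IsSolution S.g w U)
    (h0 : U 0 0 = 0) (h1 : U 1 0 = 0) (k : ℕ) (a : Fin 3) :
    U a (S.node k) = U 2 0 * aeval w (S.state k a) := by
  induction k generalizing a with
  | zero => fin_cases a <;> simp [DiscreteString.state, DiscreteString.node, h0, h1]
  | succ k ih =>
    have e0 : U 0 (S.node (k + 1)) = U 2 0 * aeval w (S.state (k + 1) 0) := by
      rw [h.zero_node_succ, ih, ih, ih, S.state_succ_zero]
      simp only [map_add, map_mul, aeval_C, Complex.coe_algebraMap]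
      ring
    have e1 : U 1 (S.node (k + 1)) = U 2 0 * aeval w (S.state (k + 1) 1) := by
      rw [h.one_node_succ, ih, ih, S.state_succ_one]
      simp only [map_add, map_mul, aeval_C, Complex.coe_algebraMap]
      ring
    have e2 : U 2 (S.node (k + 1)) = U 2 0 * aeval w (S.state (k + 1) 2) := by
      rw [h.two_node_succ, ih, e0, S.state_succ_two]
      simp only [map_add, map_mul, aeval_C, aeval_X, Complex.coe_algebraMap]
      ring
    fin_cases a
    exacts [e0, e1, e2]

theorem DiscreteString.phi_eq_aeval_charPoly (a : Fin 3) (z : ℂ) :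
    S.phi z a 1 = aeval (-z) (S.charPoly a) := by
  obtain ⟨h, h0⟩ := S.phi_spec z
  have := h.eq_aeval_state (by simp [h0]) (by simp [h0]) (n + 1) a
  rw [S.node_succ_of_le le_rfl] at this
  simpa [h0, DiscreteString.charPoly] using this

/-- The spectrum is the zero set of the characteristic polynomial. -/
theorem DiscreteString.mem_spectrum_iff (a : Fin 3) (z : ℂ) :
    z ∈ S.spectrum a ↔ aeval (-z) (S.charPoly a) = 0 := by
  constructor
  · rintro ⟨U, hU, h0, h1, ha, ξ, hξ, hne⟩
    have h := hU.eq_aeval_state h0 h1 (n + 1) a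
    rw [S.node_succ_of_le le_rfl, ha] at h
    -- With `U 2 0 = 0` as well, `U` vanishes at every mass and hence everywhere.
    refine (mul_eq_zero.1 h.symm).resolve_left fun h2 => hne ?_
    have hz : ∀ j, U 0 (S.pos j) = 0 := fun j => by
      rw [← S.node_succ_of_lt j.2, hU.eq_aeval_state h0 h1, h2, zero_mul]
    simp [hU.zero_eq hξ, h0, h1, h2, hz]
  · intro hz
    obtain ⟨h, h0⟩ := S.phi_spec z
    refine ⟨S.phi z, h, by simp [h0], by simp [h0], ?_, ?_⟩
    · rw [S.phi_eq_aeval_charPoly, hz]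
    · by_contra! hcon
      -- If `φ` vanished identically, its formula at `ξ = 1` would read `0 = 1 / 2`.
      have h1 := S.phi_zero_eq z (ξ := 1) (by simp)
      rw [hcon 1 (by simp)] at h1
      simp [fun j => hcon _ (S.pos_mem j)] at h1

/-! ### Zeros and degrees of the characteristic polynomials -/

/-- Any linear `E` turning multiplication by `X` into `planeMul a b c` transports the recursion to
the plane, where each node step is a propagation followed by a jump. -/
theorem DiscreteString.interlaced_state {a b c : ℝ} (hb : 0 ≤ b) (hc : 0 < c)
    (E : ℝ[X] →ₗ[ℝ] ℝ × ℝ) (hE1 : E 1 = (1, 0))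
    (hEX : ∀ f, E (X * f) = planeMul a b c (E f)) (hn : 0 < n) (k : ℕ) :
    Interlaced a b c (E (S.state (k + 1) 0)) (E (S.state (k + 1) 1)) (E (S.state (k + 1) 2)) := by
  have hC : ∀ (t : ℝ) f, E (C t * f) = t • E f := fun t f => by
    rw [← smul_eq_C_mul, map_smul]
  induction k with
  | zero =>
    have := interlaced_initial (a := a) (b := b) hc
      (sub_pos.2 (S.node_lt_succ hn)) (S.nodeMass_pos hn)
    simp only [S.state_succ_two, S.state_succ_one, S.state_succ_zero, map_add, hC, hEX]
    simpa [DiscreteString.state, hE1] using this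
  | succ k ih =>
    have := (ih.propagate hb hc.le (sub_nonneg.2 (S.node_le_succ (k + 1)))).jump hb hc.le
      (S.nodeMass_nonneg (k + 1))
    rw [S.state_succ_two (k + 1), S.state_succ_one (k + 1), S.state_succ_zero (k + 1)]
    simpa only [map_add, hC, hEX] using this

theorem DiscreteString.wronskian_pos (hn : 0 < n) (x : ℝ) :
    (0 < (S.charPoly 0).eval x * (derivative (S.charPoly 2)).eval x -
      (derivative (S.charPoly 0)).eval x * (S.charPoly 2).eval x) ∧
    (0 < (S.charPoly 1).eval x * (derivative (S.charPoly 2)).eval x -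
      (derivative (S.charPoly 1)).eval x * (S.charPoly 2).eval x) := by
  -- `E f = (f(x), f'(x))`; the product rule gives `planeMul x 0 1`, and the bracket is the
  -- Wronskian.
  have h := S.interlaced_state (a := x) le_rfl one_pos
    ((leval x).prod (leval x ∘ₗ derivative)) (by simp)
    (by intro f; simp [planeMul, derivative_mul]) hn n
  exact ⟨h.pr, h.qr⟩

theorem DiscreteString.im_pos (hn : 0 < n) {x : ℂ} (hx : 0 < x.im) :
    (0 < (aeval x (S.charPoly 0)).re * (aeval x (S.charPoly 2)).im -
      (aeval x (S.charPoly 0)).im * (aeval x (S.charPoly 2)).re) ∧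
    (0 < (aeval x (S.charPoly 1)).re * (aeval x (S.charPoly 2)).im -
      (aeval x (S.charPoly 1)).im * (aeval x (S.charPoly 2)).re) := by
  -- `E f = (Re f(x), Im f(x))`, with `X` acting as complex multiplication by `x`; the bracket of `E
  -- f` and `E h` is the imaginary part of `conj (f(x)) * h(x)`.
  have h := S.interlaced_state (a := x.re) hx.le hx
    ((Complex.reLm.prod Complex.imLm) ∘ₗ (aeval x).toLinearMap) (by simp)
    (by intro f; simp [planeMul]; ring) hn n
  exact ⟨h.pr, h.qr⟩

theorem aeval_conj_eq_zero {f : ℝ[X]} {x : ℂ} (h : aeval x f = 0) :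
    aeval (starRingEnd ℂ x) f = 0 := by
  rw [aeval_conj, h, map_zero]

theorem DiscreteString.im_eq_zero_of_charPoly (hn : 0 < n) (a : Fin 3) {x : ℂ}
    (h : aeval x (S.charPoly a) = 0) : x.im = 0 := by
  have main : ∀ y : ℂ, aeval y (S.charPoly a) = 0 → ¬ 0 < y.im := by
    intro y hy hpos
    obtain ⟨h0, h1⟩ := S.im_pos hn hpos
    fin_cases a
    · simp only [Fin.zero_eta] at hy
      simp [hy] at h0
    · simp only [Fin.mk_one] at hy
      simp [hy] at h1
    · simp only [Fin.reduceFinMk] at hy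
      simp [hy] at h0
  have h1 := main _ h
  have h2 := main _ (aeval_conj_eq_zero h)
  simp only [Complex.conj_im] at h2
  linarith

theorem aeval_ofReal (f : ℝ[X]) (x : ℝ) : aeval (x : ℂ) f = ((f.eval x : ℝ) : ℂ) := by
  simpa using aeval_algebraMap_apply ℂ x f

/-- Only the jump of the second derivative raises the degree, once per mass; the positive gaps
between nodes carry its leading coefficient to the next value of `φ`. -/
theorem DiscreteString.coeff_state {k : ℕ} (hk : k ≤ n) :
    (∀ a, (S.state k a).natDegree ≤ k) ∧ 0 ≤ (S.state k 0).coeff k ∧ 0 ≤ (S.state k 1).coeff k ∧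
      0 < (S.state k 2).coeff k := by
  induction k with
  | zero =>
    refine ⟨fun a => ?_, ?_⟩
    · fin_cases a <;> simp [DiscreteString.state]
    · simp [DiscreteString.state]
  | succ k ih =>
    obtain ⟨hd, h0, h1, h2⟩ := ih (by omega)
    have hl := sub_pos.2 (S.node_lt_succ (show k < n by omega))
    have hm := S.nodeMass_pos (show k < n by omega)
    have hC : ∀ (t : ℝ) {f : ℝ[X]} {d : ℕ}, f.natDegree ≤ d → (C t * f).natDegree ≤ d :=
      fun t f d hf => (natDegree_C_mul_le _ _).trans hf
    have d0 : (S.state (k + 1) 0).natDegree ≤ k := by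
      rw [S.state_succ_zero]
      exact natDegree_add_le_of_degree_le (natDegree_add_le_of_degree_le (hd 0) (hC _ (hd 1)))
        (hC _ (hd 2))
    have d1 : (S.state (k + 1) 1).natDegree ≤ k := by
      rw [S.state_succ_one]
      exact natDegree_add_le_of_degree_le (hd 1) (hC _ (hd 2))
    have d2 : (S.state (k + 1) 2).natDegree ≤ k + 1 := by
      rw [S.state_succ_two]
      refine natDegree_add_le_of_degree_le ((hd 2).trans k.le_succ) (hC _ ?_)
      refine natDegree_mul_le.trans ?_
      simp only [natDegree_X]
      omega
    have c0 : 0 < (S.state (k + 1) 0).coeff k := by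
      rw [S.state_succ_zero]
      simp only [coeff_add, coeff_C_mul]
      positivity
    refine ⟨fun a => ?_, ?_, ?_, ?_⟩
    · fin_cases a
      exacts [d0.trans k.le_succ, d1.trans k.le_succ, d2]
    · rw [coeff_eq_zero_of_natDegree_lt (by omega)]
    · rw [coeff_eq_zero_of_natDegree_lt (by omega)]
    · rw [S.state_succ_two]
      simp only [coeff_add, coeff_C_mul, coeff_X_mul]
      rw [coeff_eq_zero_of_natDegree_lt (lt_of_le_of_lt (hd 2) k.lt_succ_self)]
      positivity

/-- The last stretch, from `S.node n` to `1`, carries no mass. If its length is positive it passes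
the degree `n` of the second derivative on to `φ` and `φ_ξ`; if the last mass sits at `1`, only type
`2` has degree `n`. -/
theorem DiscreteString.natDegree_charPoly (a : Fin 3) (ha : S.Nondegenerate ∨ a = 2) :
    (S.charPoly a).natDegree = n ∧ 0 < (S.charPoly a).coeff n := by
  obtain ⟨hd, h0, h1, h2⟩ := S.coeff_state le_rfl
  have hm : S.nodeMass n = 0 := by simp [DiscreteString.nodeMass]
  have hC : ∀ (t : ℝ) {f : ℝ[X]} {d : ℕ}, f.natDegree ≤ d → (C t * f).natDegree ≤ d :=
    fun t f d hf => (natDegree_C_mul_le _ _).trans hf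
  have e2 : S.charPoly 2 = S.state n 2 := by
    rw [DiscreteString.charPoly, S.state_succ_two, hm]; simp
  have hdeg : (S.charPoly a).natDegree ≤ n := by
    fin_cases a
    · exact natDegree_add_le_of_degree_le (natDegree_add_le_of_degree_le (hd 0) (hC _ (hd 1)))
        (hC _ (hd 2))
    · exact natDegree_add_le_of_degree_le (hd 1) (hC _ (hd 2))
    · exact e2 ▸ hd 2
  have hco : 0 < (S.charPoly a).coeff n := by
    rcases ha with ha | rfl
    · have hl := sub_pos.2 (S.node_last_lt ha)
      fin_cases a
      · simp only [Fin.zero_eta, DiscreteString.charPoly, S.state_succ_zero, coeff_add, coeff_C_mul]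
        positivity
      · simp only [Fin.mk_one, DiscreteString.charPoly, S.state_succ_one, coeff_add, coeff_C_mul]
        positivity
      · simpa only [Fin.reduceFinMk, e2] using h2
    · rwa [e2]
  exact ⟨le_antisymm hdeg (le_natDegree_of_ne_zero hco.ne'), hco⟩

/-- The zeros of the characteristic polynomials are simple. -/
theorem DiscreteString.derivative_charPoly_ne_zero (a : Fin 3) (ha : S.Nondegenerate ∨ a = 2)
    {x : ℂ} (h : aeval x (S.charPoly a) = 0) : aeval x (derivative (S.charPoly a)) ≠ 0 := by
  rcases n.eq_zero_or_pos with hn | hn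
  · obtain ⟨hd, hc⟩ := S.natDegree_charPoly a ha
    subst hn
    rw [eq_C_of_natDegree_eq_zero hd, aeval_C] at h
    simp [hc.ne'] at h
  · obtain ⟨y, rfl⟩ : ∃ y : ℝ, x = y :=
      ⟨x.re, Complex.ext rfl (by simpa using S.im_eq_zero_of_charPoly hn a h)⟩
    rw [aeval_ofReal, Complex.ofReal_eq_zero] at h
    rw [aeval_ofReal, Ne, Complex.ofReal_eq_zero]
    intro h'
    obtain ⟨h0, h1⟩ := S.wronskian_pos hn y
    fin_cases a
    · simp only [Fin.zero_eta] at h h'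
      simp [h, h'] at h0
    · simp only [Fin.mk_one] at h h'
      simp [h, h'] at h1
    · simp only [Fin.reduceFinMk] at h h'
      simp [h, h'] at h0

/-! ### The spectra -/

theorem DiscreteString.spectrum_eq_image (a : Fin 3) (ha : S.Nondegenerate ∨ a = 2) :
    S.spectrum a = Neg.neg '' (S.charPoly a).rootSet ℂ := by
  have hne : S.charPoly a ≠ 0 := by
    intro h
    have := (S.natDegree_charPoly a ha).2
    simp [h] at this
  ext z
  rw [S.mem_spectrum_iff, Set.image_neg_eq_neg, Set.mem_neg, mem_rootSet]
  simp [hne]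

theorem DiscreteString.finite_spectrum (a : Fin 3) (ha : S.Nondegenerate ∨ a = 2) :
    (S.spectrum a).Finite := by
  rw [S.spectrum_eq_image a ha]
  exact (rootSet_finite _ _).image _

theorem DiscreteString.card_spectrum (a : Fin 3) (ha : S.Nondegenerate ∨ a = 2) :
    Nat.card (S.spectrum a) = n := by
  have hsep : (S.charPoly a).Separable := by
    rw [Polynomial.Separable, isCoprime_iff_aeval_ne_zero_of_isAlgClosed ℝ ℂ]
    intro x
    by_cases hx : aeval x (S.charPoly a) = 0
    · exact Or.inr (S.derivative_charPoly_ne_zero a ha hx)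
    · exact Or.inl hx
  rw [S.spectrum_eq_image a ha, Nat.card_image_of_injective neg_injective, Nat.card_eq_fintype_card,
    card_rootSet_eq_natDegree hsep (IsAlgClosed.splits _), (S.natDegree_charPoly a ha).1]

/-! ### Biorthogonality and the diagonal pairings -/

theorem DiscreteString.hasDerivAt_phi_one (a : Fin 3) (z : ℂ) :
    HasDerivAt (fun s : ℂ => S.phi s a 1) (-aeval (-z) (derivative (S.charPoly a))) z := by
  have h : (fun s : ℂ => S.phi s a 1) = fun s => aeval (-s) (S.charPoly a) :=
    funext fun s => S.phi_eq_aeval_charPoly a s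
  rw [h]
  have := (Polynomial.hasDerivAt_aeval (S.charPoly a) (-z)).comp z (hasDerivAt_neg z)
  simpa [Function.comp_def] using this

/-- Off the diagonal the pairings of eigenfunctions vanish. -/
theorem DiscreteString.pairing_eq_zero (a : Fin 3) {z z' : ℂ} (hz : z ∈ S.spectrum a)
    (hz' : z' ∈ S.spectrum a) (h : z' ≠ z) :
    S.pairing (S.phiStar a z' 0) (S.phi z 0) = 0 := by
  have := S.pairing_mul_sub' a z z'
  rw [S.phi_eq_aeval_charPoly, S.phi_eq_aeval_charPoly, (S.mem_spectrum_iff a z).1 hz,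
    (S.mem_spectrum_iff a z').1 hz', sub_zero, mul_zero] at this
  exact (mul_eq_zero.1 this).resolve_left (sub_ne_zero.2 h)

theorem DiscreteString.continuous_phi_pos (i : Fin n) :
    Continuous fun s : ℂ => S.phi s 0 (S.pos i) := by
  have : (fun s : ℂ => S.phi s 0 (S.pos i)) = fun s => aeval (-s) (S.state (i + 1) 0) := by
    funext s
    obtain ⟨h, h0⟩ := S.phi_spec s
    have := h.eq_aeval_state (by simp [h0]) (by simp [h0]) (i + 1) 0
    rw [S.node_succ_of_lt i.2] at this
    simpa [h0] using this
  rw [this]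
  exact (Polynomial.continuous_aeval _).comp continuous_neg

theorem DiscreteString.pairing_eq_sum (f h : ℝ → ℂ) :
    S.pairing f h = ∑ i, (S.mass i : ℂ) * (f (S.pos i) * h (S.pos i)) :=
  S.integral_Icc_g _

/-- The Lagrange identity for `s ≠ z` equates the pairing with a difference quotient of `φ^(a)(1;
·)` up to sign; let `s → z`. -/
theorem DiscreteString.pairing_self (a : Fin 3) (z : ℂ) :
    S.pairing (S.phiStar a z 0) (S.phi z 0) =
      (-1) ^ (a : ℕ) * aeval (-z) (derivative (S.charPoly a)) := by
  have hcont : Continuous fun s : ℂ => S.pairing (S.phiStar a z 0) (S.phi s 0) := by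
    simp only [S.pairing_eq_sum]
    exact continuous_finsetSum _ fun i _ =>
      continuous_const.mul (continuous_const.mul (S.continuous_phi_pos i))
  have h1 : Filter.Tendsto (fun s : ℂ => S.pairing (S.phiStar a z 0) (S.phi s 0))
      (nhdsWithin z {z}ᶜ) (nhds (S.pairing (S.phiStar a z 0) (S.phi z 0))) :=
    (hcont.tendsto z).mono_left nhdsWithin_le_nhds
  have h2 := (hasDerivAt_iff_tendsto_slope.1 (S.hasDerivAt_phi_one a z)).const_mul
    (-(-1) ^ (a : ℕ))
  refine (tendsto_nhds_unique (h1.congr' ?_) h2).trans (by ring)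
  filter_upwards [self_mem_nhdsWithin] with s hs
  have hs' : z - s ≠ 0 := sub_ne_zero.2 (Ne.symm hs)
  have hs'' : s - z ≠ 0 := sub_ne_zero.2 hs
  have := S.pairing_mul_sub' a s z
  rw [slope_def_field]
  field_simp
  linear_combination -this

theorem DiscreteString.pairing_ne_zero (a : Fin 3) (ha : S.Nondegenerate ∨ a = 2) {z : ℂ}
    (hz : z ∈ S.spectrum a) : S.pairing (S.phiStar a z 0) (S.phi z 0) ≠ 0 := by
  rw [S.pairing_self]
  exact mul_ne_zero (by simp) (S.derivative_charPoly_ne_zero a ha ((S.mem_spectrum_iff a z).1 hz))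

/-! ### Inversion of the transforms -/

theorem DiscreteString.fourier_eq_sum (a : Fin 3) (f : ℝ → ℂ) (z : ℂ) :
    S.fourier a f z =
      (-1) ^ (a : ℕ) * ∑ i, S.mass i * (S.phiStar a z 0 (S.pos i) * f (S.pos i)) := by
  rw [DiscreteString.fourier, S.integral_Icc_g]

theorem integral_sum_smul_dirac {σ : Set ℂ} [Fintype σ] (b : ℂ → ℝ≥0∞) (hb : ∀ z, b z ≠ ∞)
    (F : ℂ → ℂ) : ∫ z, F z ∂(Measure.sum fun z : σ => b z • Measure.dirac (z : ℂ)) =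
      ∑ z : σ, ((b z).toReal : ℂ) * F z := by
  rw [Measure.sum_fintype, integral_finsetSum_measure]
  · simp [integral_smul_measure]
  · exact fun z _ => (integrable_dirac (by simp)).smul_measure (hb z)

theorem DiscreteString.invFourier_eq_sum (a : Fin 3) [Fintype (S.spectrum a)] (F : ℂ → ℂ) (ξ : ℝ) :
    S.invFourier a F ξ = (-1) ^ (a : ℕ) * ∑ z : S.spectrum a,
      F z * (S.phi z 0 ξ / S.pairing (S.phiStar a z 0) (S.phi z 0)) := by
  have := integral_sum_smul_dirac (σ := S.spectrum a) (fun _ => 1) (by simp)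
    fun z => F z * (S.phi z 0 ξ / S.pairing (S.phiStar a z 0) (S.phi z 0))
  simp only [one_smul, ENNReal.toReal_one, Complex.ofReal_one, one_mul] at this
  rw [DiscreteString.invFourier, DiscreteString.nu, this]

/-- The matrix of the transform of type `a`. -/
noncomputable def DiscreteString.fourierMatrix (a : Fin 3) : Matrix (S.spectrum a) (Fin n) ℂ :=
  fun z i => (-1) ^ (a : ℕ) * (S.mass i * S.phiStar a z 0 (S.pos i))

/-- The matrix of the inverse transform of type `a`. -/
noncomputable def DiscreteString.invFourierMatrix (a : Fin 3) : Matrix (Fin n) (S.spectrum a) ℂ :=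
  fun i z => (-1) ^ (a : ℕ) * (S.phi z 0 (S.pos i) / S.pairing (S.phiStar a z 0) (S.phi z 0))

theorem neg_one_pow_mul_self' (k : ℕ) : ((-1 : ℂ) ^ k) * (-1) ^ k = 1 := by
  rw [← mul_pow]; simp

theorem DiscreteString.fourierMatrix_mul_invFourierMatrix (a : Fin 3)
    (ha : S.Nondegenerate ∨ a = 2) [DecidableEq (S.spectrum a)] :
    S.fourierMatrix a * S.invFourierMatrix a = 1 := by
  ext z z'
  have h : (S.fourierMatrix a * S.invFourierMatrix a) z z' =
      S.pairing (S.phiStar a z 0) (S.phi z' 0) / S.pairing (S.phiStar a z' 0) (S.phi z' 0) := by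
    rw [Matrix.mul_apply, S.pairing_eq_sum (S.phiStar a z 0), Finset.sum_div]
    refine Finset.sum_congr rfl fun i _ => ?_
    simp only [DiscreteString.fourierMatrix, DiscreteString.invFourierMatrix]
    linear_combination ((S.mass i : ℂ) * S.phiStar a z 0 (S.pos i) *
      (S.phi z' 0 (S.pos i) / S.pairing (S.phiStar a z' 0) (S.phi z' 0))) *
      neg_one_pow_mul_self' (a : ℕ)
  rw [h, Matrix.one_apply]
  split_ifs with hz
  · rw [hz, div_self (S.pairing_ne_zero a ha z'.2)]
  · rw [S.pairing_eq_zero a z'.2 z.2 fun h' => hz (Subtype.ext h'), zero_div]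

theorem DiscreteString.fourier_eq_mulVec (a : Fin 3) (f : ℝ → ℂ) (z : S.spectrum a) :
    S.fourier a f z = (S.fourierMatrix a).mulVec (fun i => f (S.pos i)) z := by
  rw [S.fourier_eq_sum, Matrix.mulVec, dotProduct, Finset.mul_sum]
  exact Finset.sum_congr rfl fun i _ => by simp only [DiscreteString.fourierMatrix]; ring

theorem DiscreteString.invFourier_eq_mulVec (a : Fin 3) [Fintype (S.spectrum a)] (F : ℂ → ℂ)
    (i : Fin n) : S.invFourier a F (S.pos i) =
      (S.invFourierMatrix a).mulVec (fun z => F z) i := by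
  rw [S.invFourier_eq_sum, Matrix.mulVec, dotProduct, Finset.mul_sum]
  exact Finset.sum_congr rfl fun z _ => by simp only [DiscreteString.invFourierMatrix]; ring

theorem DiscreteString.fourier_invFourier (a : Fin 3) (ha : S.Nondegenerate ∨ a = 2)
    (F : ℂ → ℂ) {z : ℂ} (hz : z ∈ S.spectrum a) : S.fourier a (S.invFourier a F) z = F z := by
  classical
  have := (S.finite_spectrum a ha).fintype
  rw [S.fourier_eq_mulVec a _ ⟨z, hz⟩]
  simp only [S.invFourier_eq_mulVec]
  rw [Matrix.mulVec_mulVec, S.fourierMatrix_mul_invFourierMatrix a ha, Matrix.one_mulVec]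

theorem DiscreteString.invFourier_fourier (a : Fin 3) (ha : S.Nondegenerate ∨ a = 2)
    (f : ℝ → ℂ) (i : Fin n) : S.invFourier a (S.fourier a f) (S.pos i) = f (S.pos i) := by
  classical
  have := (S.finite_spectrum a ha).fintype
  have hcard : Fintype.card (S.spectrum a) = Fintype.card (Fin n) := by
    rw [← Nat.card_eq_fintype_card, S.card_spectrum a ha, Fintype.card_fin]
  -- The spectrum has as many points as there are masses, so the matrices are square and the inverse
  -- is two-sided.
  have h := (Matrix.mul_eq_one_comm_of_equiv (Fintype.equivOfCardEq hcard)).1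
    (S.fourierMatrix_mul_invFourierMatrix a ha)
  rw [S.invFourier_eq_mulVec]
  simp only [S.fourier_eq_mulVec]
  rw [Matrix.mulVec_mulVec, h, Matrix.one_mulVec]

theorem DiscreteString.ae_g_of_pos {p : ℝ → Prop} (h : ∀ i, p (S.pos i)) : ∀ᵐ ξ ∂S.g, p ξ := by
  rw [DiscreteString.g, ← Measure.sum_fintype, Measure.ae_sum_iff]
  intro i
  refine Measure.ae_smul_measure ?_ _
  rw [ae_dirac_eq]
  exact h i

/-! ### The spectral measure of type 2 -/

theorem DiscreteString.weight_eq (z : ℂ) : S.weight z =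
    aeval (-z) (S.charPoly 1) / aeval (-z) (derivative (S.charPoly 2)) := by
  rw [DiscreteString.weight, (S.hasDerivAt_phi_one 2 z).deriv, S.phi_eq_aeval_charPoly,
    neg_div_neg_eq]

theorem DiscreteString.phi_one_ne_zero_and_weight_pos {z : ℂ} (hz : z ∈ S.spectrum 2) :
    S.phi z 1 1 ≠ 0 ∧ 0 < (S.weight z).re ∧ (S.weight z).im = 0 := by
  rw [S.mem_spectrum_iff] at hz
  -- Without masses `P_2` is a nonzero constant and the spectrum is empty.
  have hn : 0 < n := by
    by_contra! hn
    obtain ⟨hd, hc⟩ := S.natDegree_charPoly 2 (Or.inr rfl)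
    obtain rfl : n = 0 := by omega
    rw [eq_C_of_natDegree_eq_zero hd, aeval_C] at hz
    simp [hc.ne'] at hz
  obtain ⟨y, hy⟩ : ∃ y : ℝ, -z = y :=
    ⟨(-z).re, Complex.ext rfl (by simpa using S.im_eq_zero_of_charPoly hn 2 hz)⟩
  rw [S.weight_eq, S.phi_eq_aeval_charPoly]
  rw [hy] at hz ⊢
  simp only [aeval_ofReal, Complex.ofReal_eq_zero, ← Complex.ofReal_div, Complex.ofReal_re,
    Complex.ofReal_im, Ne] at hz ⊢
  -- At a zero of `P_2` the Wronskian reduces to `P_1 P_2'`, which has the sign of the weight `P_1 /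
  -- P_2'`.
  have h := (S.wronskian_pos hn y).2
  rw [hz, mul_zero, sub_zero] at h
  refine ⟨fun h0 => by simp [h0] at h, ?_, trivial⟩
  have hne : (derivative (S.charPoly 2)).eval y ≠ 0 := fun h0 => by simp [h0] at h
  have : (S.charPoly 1).eval y / (derivative (S.charPoly 2)).eval y =
      (S.charPoly 1).eval y * (derivative (S.charPoly 2)).eval y /
        (derivative (S.charPoly 2)).eval y ^ 2 := by field_simp
  rw [this]
  positivity

/-- The factor `φ_ξ(1; z) = P_1(-z)` cancels: `b(z) / φ_ξ(1; z) = 1 / P_2'(-z)`, the reciprocal of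
the pairing of type `2`. -/
theorem DiscreteString.invFourierBeta_eq (F : ℂ → ℂ) : S.invFourierBeta F = S.invFourier 2 F := by
  funext ξ
  have := (S.finite_spectrum 2 (Or.inr rfl)).fintype
  rw [S.invFourier_eq_sum, DiscreteString.invFourierBeta, DiscreteString.beta,
    integral_sum_smul_dirac (fun z => ENNReal.ofReal (S.weight z).re) (by simp)]
  simp only [Fin.val_two, neg_one_sq, one_mul]
  refine Finset.sum_congr rfl fun z _ => ?_
  obtain ⟨h1, h2, h3⟩ := S.phi_one_ne_zero_and_weight_pos z.2
  have hw : (((S.weight z).re : ℝ) : ℂ) = S.weight z := Complex.ext rfl (by simp [h3])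
  have hp : S.pairing (S.phiStar 2 z 0) (S.phi z 0) ≠ 0 := S.pairing_ne_zero 2 (Or.inr rfl) z.2
  rw [ENNReal.toReal_ofReal h2.le, hw, S.weight_eq, ← S.phi_eq_aeval_charPoly]
  rw [S.pairing_self] at hp ⊢
  simp only [Fin.val_two, neg_one_sq, one_mul] at hp ⊢
  field_simp

end CubicString

theorem mainTheorem9 {n : ℕ} (S : CubicString.DiscreteString n) :
    (∀ a : Fin 3, (S.Nondegenerate ∨ a = 2) →
      (S.spectrum a).Finite ∧
      (∀ z ∈ S.spectrum a, S.pairing (S.phiStar a z 0) (S.phi z 0) ≠ 0) ∧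
      (∀ f : ℝ → ℂ, MeasureTheory.MemLp f 2 S.g →
        ∀ᵐ ξ ∂S.g, f ξ = S.invFourier a (S.fourier a f) ξ) ∧
      (∀ F : ℂ → ℂ, ∀ z ∈ S.spectrum a, S.fourier a (S.invFourier a F) z = F z)) ∧
    ((∀ z ∈ S.spectrum 2, S.phi z 1 1 ≠ 0 ∧ 0 < (S.weight z).re ∧ (S.weight z).im = 0) ∧
      (∀ f : ℝ → ℂ, MeasureTheory.MemLp f 2 S.g →
        ∀ᵐ ξ ∂S.g, f ξ = S.invFourierBeta (S.fourier 2 f) ξ) ∧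
      (∀ F : ℂ → ℂ, ∀ z ∈ S.spectrum 2, S.fourier 2 (S.invFourierBeta F) z = F z)) := by
  refine ⟨fun a ha => ⟨S.finite_spectrum a ha, fun z hz => S.pairing_ne_zero a ha hz, ?_,
    fun F z hz => S.fourier_invFourier a ha F hz⟩,
    fun z hz => S.phi_one_ne_zero_and_weight_pos hz, ?_, ?_⟩
  · exact fun f _ => S.ae_g_of_pos fun i => (S.invFourier_fourier a ha f i).symm
  · intro f _
    rw [S.invFourierBeta_eq]
    exact S.ae_g_of_pos fun i => (S.invFourier_fourier 2 (Or.inr rfl) f i).symm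
  · intro F z hz
    rw [S.invFourierBeta_eq]
    exact S.fourier_invFourier 2 (Or.inr rfl) F hz
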